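/- **The game.** Let $n\ge 2$ and $\lambda>0$. In the fault-prone Hotelling game $\mathrm{FPH}(n,\lambda)$ each of $n$ servers chooses a location $x_i\in[0,1]$. Faults occur on $[0,1]$ according to a Poisson process with rate $\lambda$, and each client (clients are uniformly distributed on $[0,1]$) chooses the closest server that is not separated from it by a fault. Thus the market of server $i$ is the segment $[L_i,R_i]$ where $R_i$ is the fault closest to $x_i$ on its right if that fault lies between $x_i$ and the next occupied location $x_i^r>x_i$ (between $x_i$ and $1$, if no location to the right of $x_i$ is occupied); if there is no such fault, $R_i=(x_i+x_i^r)/2$ (respectively $R_i=1$). $L_i$ is defined symmetrically. The payoff of server $i$ is $\mathbb E[R_i-L_i]/\gamma_i$, where $\gamma_i$ is the number of servers located at $x_i$. A Nash equilibrium is a profile in $[0,1]^n$ in which no server can increase its payoff by moving to another location in $[0,1]$. A pair $(H,M)\in[0,1]^2$ is a *canonical pair* of $\mathrm{FPH}(n,\lambda)$ if $$e^{\lambda(M-H)}=\frac{1+\lambda M}{2},\qquad 2H+(n-1)M=1,\qquad \lambda H>\ln 2 .$$ **Corollary.** Let $c(\alpha)=\ln\left(\frac{1+\alpha}{2}\right)/\alpha$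 for $\alpha>0$. The function $c$ attains a maximum value $c_{\max}$ on $(0,\infty)$. There is exactly one pair $(\alpha_0,\beta_0)$ with $\alpha_0,\beta_0>0$ and $$e^{-\alpha_0}(1+\alpha_0)=e^{-2\beta_0}(1+\beta_0),\qquad e^{-\alpha_0}\left(1+\tfrac{\alpha_0}{2}\right)=e^{-\beta_0}\left(\tfrac34+\tfrac{\beta_0}{2}\right);$$ put $c_{\min}=c(\alpha_0)$. Then $c_{\max}\approx 0.232$ and $c_{\min}\approx-0.392$ (each with error at most $0.0005$), and for all integers $n\ge2$ and reals $\lambda>0$: if $(H,M)$ is a canonical pair of $\mathrm{FPH}(n,\lambda)$, then $$H/M\ge 1-c_{\max},$$ and if moreover $n\ge3$ and $\mathrm{FPH}(n,\lambda)$ has a Nash equilibrium, then also $$H/M\le 1-c_{\min}.$$ -/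

import Mathlib

open MeasureTheory ProbabilityTheory Set

noncomputable section

namespace FaultHotelling

/-- The number of faults in the segment `[a, b]`. -/
def faultCount (F : Set ℝ) (a b : ℝ) : ℕ := (F ∩ Icc a b).ncard

/-- `F` is (the set of points of) a Poisson process of rate `lam` on the segment `[0, 1]`, defined on
the probability space `(Ω, P)`: a random finite subset of `[0, 1]` such that the number of faults in
a segment `[a, b]` is Poisson distributed with mean `lam * (b - a)`, and the numbers of faults in
finitely many pairwise disjoint segments are independent. -/
structure IsPoissonFaults {Ω : Type*} [MeasurableSpace Ω] (P : Measure Ω) (lam : ℝ)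
    (F : Ω → Set ℝ) : Prop where
  subset_unit : ∀ ω, F ω ⊆ Icc 0 1
  finite : ∀ ω, (F ω).Finite
  measurable_count : ∀ a b : ℝ, 0 ≤ a → a ≤ b → b ≤ 1 →
    Measurable fun ω => faultCount (F ω) a b
  count_law : ∀ a b : ℝ, 0 ≤ a → a ≤ b → b ≤ 1 → ∀ k : ℕ,
    P.real {ω | faultCount (F ω) a b = k} =
      Real.exp (-(lam * (b - a))) * (lam * (b - a)) ^ k / (k.factorial : ℝ)
  indep_count : ∀ (m : ℕ) (a b : Fin m → ℝ),
    (∀ j, 0 ≤ a j ∧ a j ≤ b j ∧ b j ≤ 1) →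
    Pairwise (fun j k => Disjoint (Icc (a j) (b j)) (Icc (a k) (b k))) →
    iIndepFun (fun j ω => faultCount (F ω) (a j) (b j)) P

open Classical in
/-- The end of the right half-market of a server at `a` whose right region is `[a, b]`: the fault of
`[a, b]` closest to `a` if there is one, and the point `e` otherwise. -/
def rightEnd (F : Set ℝ) (a b e : ℝ) : ℝ :=
  if (F ∩ Icc a b).Nonempty then sInf (F ∩ Icc a b) else e

open Classical in
/-- The end of the left half-market of a server at `b` whose left region is `[a, b]`: the fault of
`[a, b]` closest to `b` if there is one, and the point `e` otherwise. -/
def leftEnd (F : Set ℝ) (a b e : ℝ) : ℝ :=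
  if (F ∩ Icc a b).Nonempty then sSup (F ∩ Icc a b) else e

/-- The locations occupied strictly to the right of server `i`. -/
def locsRight {n : ℕ} (x : Fin n → ℝ) (i : Fin n) : Set ℝ := range x ∩ Ioi (x i)

/-- The locations occupied strictly to the left of server `i`. -/
def locsLeft {n : ℕ} (x : Fin n → ℝ) (i : Fin n) : Set ℝ := range x ∩ Iio (x i)

/-- The location of the right neighbor of `i` (meaningful if `i` is not right peripheral). -/
def rightNeighbor {n : ℕ} (x : Fin n → ℝ) (i : Fin n) : ℝ := sInf (locsRight x i)

/-- The location of the left neighbor of `i` (meaningful if `i` is not left peripheral). -/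
def leftNeighbor {n : ℕ} (x : Fin n → ℝ) (i : Fin n) : ℝ := sSup (locsLeft x i)

open Classical in
/-- The right end of the market of server `i`. The clients choose the closest server that is not
disconnected from them by a fault, so without a fault on the right region the market extends to
the midpoint between `i` and its right neighbor, or to `1` if `i` is right peripheral. -/
def marketRight {n : ℕ} (F : Set ℝ) (x : Fin n → ℝ) (i : Fin n) : ℝ :=
  if (locsRight x i).Nonempty then
    rightEnd F (x i) (rightNeighbor x i) ((x i + rightNeighbor x i) / 2)
  else rightEnd F (x i) 1 1

open Classical in
/-- The left end of the market of server `i`. -/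
def marketLeft {n : ℕ} (F : Set ℝ) (x : Fin n → ℝ) (i : Fin n) : ℝ :=
  if (locsLeft x i).Nonempty then
    leftEnd F (leftNeighbor x i) (x i) ((leftNeighbor x i + x i) / 2)
  else leftEnd F 0 (x i) 0

/-- The payoff of server `i`: the expected length of its market, divided by the number of servers
located at the same point (server `i` included). -/
def payoff {Ω : Type*} [MeasurableSpace Ω] (P : Measure Ω) (F : Ω → Set ℝ) {n : ℕ}
    (x : Fin n → ℝ) (i : Fin n) : ℝ :=
  (∫ ω, (marketRight (F ω) x i - marketLeft (F ω) x i) ∂P) / (({j | x j = x i} : Set (Fin n)).ncard : ℝ)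

/-- The profile `x` is a (pure) Nash equilibrium. -/
def IsNash {Ω : Type*} [MeasurableSpace Ω] (P : Measure Ω) (F : Ω → Set ℝ) {n : ℕ}
    (x : Fin n → ℝ) : Prop :=
  (∀ i, x i ∈ Icc (0 : ℝ) 1) ∧
    ∀ i, ∀ y ∈ Icc (0 : ℝ) 1, payoff P F (Function.update x i y) i ≤ payoff P F x i

/-- `(H, M)` is a canonical pair of the game with `n` servers and fault rate `lam`. -/
structure IsCanonicalPair (n : ℕ) (lam H M : ℝ) : Prop where
  H_mem : H ∈ Icc (0 : ℝ) 1
  M_mem : M ∈ Icc (0 : ℝ) 1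
  optimal : Real.exp (lam * (M - H)) = (1 + lam * M) / 2
  total : 2 * H + ((n : ℝ) - 1) * M = 1
  minimal : Real.log 2 < lam * H

/-- The function `c(α) = ln((1 + α) / 2) / α`. -/
def cFun (α : ℝ) : ℝ := Real.log ((1 + α) / 2) / α

/-- The intersection points `(α, β)`, `α, β > 0`, of the two curves whose crossing
defines `α₀`. -/
def crossing : Set (ℝ × ℝ) :=
  {p | 0 < p.1 ∧ 0 < p.2 ∧
    Real.exp (-p.1) * (1 + p.1) = Real.exp (-(2 * p.2)) * (1 + p.2) ∧
    Real.exp (-p.1) * (1 + p.1 / 2) = Real.exp (-p.2) * (3 / 4 + p.2 / 2)}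

end FaultHotelling

end

/-! Measure lengths in units of the mean fault distance `1/λ` and put `a = λM`. The optimality
equation of a canonical pair says `λH = a - ln((1+a)/2)`, so `H/M = 1 - c(a)`, and the lower bound
on `H/M` is the maximality of `c_max`.

For the upper bound it suffices that `a ≥ α₀`, because `α₀ ≤ 1` and hence `c(α₀) ≤ c(a)`
(`cFun_le_cFun`). Expected half-markets have the closed forms `neighborHalf` and `peripheralHalf`
(`payoff_eq`). For `n ≥ 3` no location is shared (`IsValueNash.injective`), strict concavity of
`neighborHalf` puts each interior server at the midpoint of its neighbors, and the first-order
conditions at the two ends fix the rest: a sorted equilibrium is the canonical profile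
(`IsValueNash.eq_canonical`).

An interior server then earns `2 * neighborHalf a` and must not gain by becoming peripheral. The
move that meets the peripheral first-order condition ends at distance `b/λ` from the old peripheral
server, with `(a, b)` on the first curve, and it is unprofitable iff `e^{-a}(1+a/2) ≤
e^{-b}(3/4+b/2)` (`IsValueNash.curve_le`). Along the first curve this inequality, once true, is
strict further on (`curve_lt_of_curve_le`). At `(α₀, β₀)` it is an equality, so `a < α₀` is
impossible. The same lemma makes the crossing unique. -/

namespace FaultHotelling

/-! ### Half-market functions: monotonicity and concavity -/

/-- The expected half-market, at unit fault rate, towards a neighbor at distance `d`. -/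
noncomputable def neighborHalf (d : ℝ) : ℝ := 1 - Real.exp (-d) * (1 + d / 2)

/-- The expected half-market, at unit fault rate, of a peripheral server towards the end of the
segment at distance `d`. -/
noncomputable def peripheralHalf (d : ℝ) : ℝ := 1 - Real.exp (-d)

lemma hasDerivAt_neighborHalf (d : ℝ) :
    HasDerivAt neighborHalf (Real.exp (-d) * (1 + d) / 2) d := by
  have h1 : HasDerivAt (fun t : ℝ => Real.exp (-t)) (Real.exp (-d) * (-1)) d :=
    (hasDerivAt_neg d).exp
  have h2 : HasDerivAt (fun t : ℝ => 1 + t / 2) (1 / 2) d :=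
    ((hasDerivAt_id d).div_const 2).const_add 1
  exact ((h1.mul h2).const_sub 1).congr_deriv (by ring)

lemma hasDerivAt_peripheralHalf (d : ℝ) : HasDerivAt peripheralHalf (Real.exp (-d)) d := by
  have h1 : HasDerivAt (fun t : ℝ => Real.exp (-t)) (Real.exp (-d) * (-1)) d :=
    (hasDerivAt_neg d).exp
  exact (h1.const_sub 1).congr_deriv (by ring)

lemma continuous_neighborHalf : Continuous neighborHalf := by
  unfold neighborHalf; fun_prop

lemma continuous_peripheralHalf : Continuous peripheralHalf := by
  unfold peripheralHalf; fun_prop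

/-- `e^{-a} (1 + a)` is strictly decreasing on `[0, ∞)`. -/
lemma exp_neg_mul_one_add_lt {a b : ℝ} (ha : 0 ≤ a) (hab : a < b) :
    Real.exp (-b) * (1 + b) < Real.exp (-a) * (1 + a) := by
  have h : (b - a) + 1 < Real.exp (b - a) := Real.add_one_lt_exp (by linarith)
  have h1 : Real.exp (-a) = Real.exp (-b) * Real.exp (b - a) := by
    rw [← Real.exp_add]; ring_nf
  rw [h1, mul_assoc]
  apply mul_lt_mul_of_pos_left _ (Real.exp_pos _)
  nlinarith [mul_nonneg ha (sub_nonneg.2 hab.le)]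

lemma exp_neg_two_mul_one_add_lt {a b : ℝ} (ha : 0 ≤ a) (hab : a < b) :
    Real.exp (-(2 * b)) * (1 + b) < Real.exp (-(2 * a)) * (1 + a) := by
  have e : ∀ t : ℝ, Real.exp (-(2 * t)) * (1 + t) = Real.exp (-t) * (Real.exp (-t) * (1 + t)) := by
    intro t; rw [← mul_assoc, ← Real.exp_add]; ring_nf
  rw [e, e]
  apply mul_lt_mul'' (Real.exp_lt_exp.2 (by linarith)) (exp_neg_mul_one_add_lt ha hab)
    (Real.exp_pos _).le
  have := Real.exp_pos (-b)
  have : 0 < 1 + b := by linarith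
  positivity

lemma strictConcaveOn_neighborHalf : StrictConcaveOn ℝ (Ici 0) neighborHalf := by
  apply StrictAntiOn.strictConcaveOn_of_deriv (convex_Ici 0) continuous_neighborHalf.continuousOn
  intro a ha b hb hab
  rw [interior_Ici] at ha
  rw [(hasDerivAt_neighborHalf a).deriv, (hasDerivAt_neighborHalf b).deriv]
  linarith [exp_neg_mul_one_add_lt (le_of_lt ha) hab]

lemma neighborHalf_zero : neighborHalf 0 = 0 := by simp [neighborHalf]

lemma peripheralHalf_zero : peripheralHalf 0 = 0 := by simp [peripheralHalf]

lemma neighborHalf_add_lt {u v : ℝ} (hu : 0 ≤ u) (hv : 0 ≤ v) (huv : u ≠ v) :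
    neighborHalf u + neighborHalf v < 2 * neighborHalf ((u + v) / 2) := by
  have := strictConcaveOn_neighborHalf.2 (mem_Ici.2 hu) (mem_Ici.2 hv) huv
    (show (0 : ℝ) < 1 / 2 by norm_num) (show (0 : ℝ) < 1 / 2 by norm_num) (by norm_num)
  simp only [smul_eq_mul] at this
  rw [show 1 / 2 * u + 1 / 2 * v = (u + v) / 2 by ring] at this
  linarith

/-- Concavity with `neighborHalf 0 = 0`: the midpoint of a gap earns strictly more than a position
at its end earns from that gap. -/
lemma neighborHalf_lt_two_mul {d : ℝ} (hd : 0 < d) :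
    neighborHalf d < 2 * neighborHalf (d / 2) := by
  have := neighborHalf_add_lt hd.le le_rfl hd.ne'
  rw [neighborHalf_zero, add_zero, add_zero] at this
  exact this

lemma neighborHalf_le_peripheralHalf {d : ℝ} (hd : 0 ≤ d) : neighborHalf d ≤ peripheralHalf d := by
  unfold neighborHalf peripheralHalf
  have := mul_nonneg (Real.exp_pos (-d)).le hd
  nlinarith

lemma neighborHalf_pos {d : ℝ} (hd : 0 < d) : 0 < neighborHalf d := by
  unfold neighborHalf
  have h := exp_neg_mul_one_add_lt le_rfl hd
  have := mul_pos (Real.exp_pos (-d)) hd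
  simp at h
  nlinarith

lemma neighborHalf_nonneg {d : ℝ} (hd : 0 ≤ d) : 0 ≤ neighborHalf d := by
  rcases hd.eq_or_lt with rfl | h
  · rw [neighborHalf_zero]
  · exact (neighborHalf_pos h).le

lemma peripheralHalf_pos {d : ℝ} (hd : 0 < d) : 0 < peripheralHalf d :=
  (neighborHalf_pos hd).trans_le (neighborHalf_le_peripheralHalf hd.le)

lemma peripheralHalf_nonneg {d : ℝ} (hd : 0 ≤ d) : 0 ≤ peripheralHalf d :=
  (neighborHalf_nonneg hd).trans (neighborHalf_le_peripheralHalf hd)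

/-- The optimality condition of a peripheral server determines its distance to the end. -/
lemma eq_sub_log_of_exp_sub_eq {m h : ℝ} (hh : Real.exp (m - h) = (1 + m) / 2) :
    h = m - Real.log ((1 + m) / 2) := by
  rw [← hh, Real.log_exp]; ring

/-- The distance of an optimal peripheral server to the end is increasing in its distance to its
neighbor. -/
lemma sub_log_lt {a b : ℝ} (ha : 0 ≤ a) (hab : a < b) :
    a - Real.log ((1 + a) / 2) < b - Real.log ((1 + b) / 2) := by
  have hb : 0 < b := ha.trans_lt hab
  have h1 : Real.log ((1 + b) / 2) - Real.log ((1 + a) / 2) = Real.log ((1 + b) / (1 + a)) := by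
    rw [← Real.log_div (by positivity) (by positivity)]
    congr 1
    field_simp
  have hq : (1 + b) / (1 + a) ≠ 1 := by
    rw [Ne, div_eq_one_iff_eq (by positivity)]; linarith
  have h2 := Real.log_lt_sub_one_of_pos (show 0 < (1 + b) / (1 + a) by
    have : 0 < 1 + b := by linarith
    positivity) hq
  have h3 : (1 + b) / (1 + a) - 1 ≤ b - a := by
    rw [div_sub_one (by positivity), div_le_iff₀ (by positivity)]
    nlinarith
  linarith

/-! ### The crossing of the two curves -/

/-- Along the first curve, once the second inequality holds it holds strictly further on. -/
lemma curve_lt_of_curve_le {a b a' b' : ℝ} (ha : 0 < a) (hb : 0 < b) (hb' : 0 < b')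
    (h : Real.exp (-a) * (1 + a) = Real.exp (-(2 * b)) * (1 + b))
    (h' : Real.exp (-a') * (1 + a') = Real.exp (-(2 * b')) * (1 + b')) (haa : a < a')
    (hle : Real.exp (-a) * (1 + a / 2) ≤ Real.exp (-b) * (3 / 4 + b / 2)) :
    Real.exp (-a') * (1 + a' / 2) < Real.exp (-b') * (3 / 4 + b' / 2) := by
  have ha' : 0 < a' := ha.trans haa
  have hbb : b < b' := by
    by_contra hcon
    rcases (not_lt.1 hcon).eq_or_lt with e | e
    · subst e; linarith [exp_neg_mul_one_add_lt ha.le haa]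
    · linarith [exp_neg_mul_one_add_lt ha.le haa, exp_neg_two_mul_one_add_lt hb'.le e]
  have sq : ∀ t : ℝ, Real.exp (-(2 * t)) = Real.exp (-t) * Real.exp (-t) := by
    intro t; rw [← Real.exp_add]; ring_nf
  rw [sq] at h h'
  have hu := Real.exp_pos (-b)
  have hu' := Real.exp_pos (-b')
  have hdec := exp_neg_mul_one_add_lt hb.le hbb
  -- Eliminating `e^{-a}` by the first curve turns the inequality into `e^{-b}(1+b) · (1+a/2)/(1+a)
  -- ≤ 3/4+b/2`. Since `b` grows with `a` on the curve, both left factors decrease and the right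
  -- side increases.
  have key : Real.exp (-b) * (1 + b) * (1 + a / 2) ≤ (3 / 4 + b / 2) * (1 + a) := by
    refine le_of_mul_le_mul_left ?_ hu
    calc _ = Real.exp (-b) * Real.exp (-b) * (1 + b) * (1 + a / 2) := by ring
      _ = Real.exp (-a) * (1 + a / 2) * (1 + a) := by rw [← h]; ring
      _ ≤ Real.exp (-b) * (3 / 4 + b / 2) * (1 + a) := by gcongr
      _ = _ := by ring
  have key' : Real.exp (-b') * (1 + b') * (1 + a' / 2) < (3 / 4 + b' / 2) * (1 + a') := by
    have e1 : Real.exp (-b') * (1 + b') * (1 + a' / 2) < Real.exp (-b) * (1 + b) * (1 + a' / 2) :=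
      mul_lt_mul_of_pos_right hdec (by positivity)
    have e2 : Real.exp (-b) * (1 + b) * (1 + a' / 2) * (1 + a)
        ≤ (3 / 4 + b / 2) * (1 + a') * (1 + a) := by
      have p : 0 ≤ Real.exp (-b) * (1 + b) := by positivity
      calc _ = Real.exp (-b) * (1 + b) * ((1 + a' / 2) * (1 + a)) := by ring
        _ ≤ Real.exp (-b) * (1 + b) * ((1 + a / 2) * (1 + a')) := by
          apply mul_le_mul_of_nonneg_left _ p; nlinarith
        _ = Real.exp (-b) * (1 + b) * (1 + a / 2) * (1 + a') := by ring
        _ ≤ (3 / 4 + b / 2) * (1 + a) * (1 + a') := by gcongr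
        _ = _ := by ring
    have e3 := le_of_mul_le_mul_right e2 (by positivity)
    have e4 : (3 / 4 + b / 2) * (1 + a') ≤ (3 / 4 + b' / 2) * (1 + a') := by gcongr
    linarith
  refine lt_of_mul_lt_mul_right (a := 1 + a') ?_ (by positivity)
  calc _ = Real.exp (-a') * (1 + a') * (1 + a' / 2) := by ring
    _ = Real.exp (-b') * (Real.exp (-b') * (1 + b') * (1 + a' / 2)) := by rw [h']; ring
    _ < Real.exp (-b') * ((3 / 4 + b' / 2) * (1 + a')) := mul_lt_mul_of_pos_left key' hu'
    _ = _ := by ring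

/-- Every point of the first curve with `a > 0` has a partner `b > 0`. -/
lemma exists_curve_partner {a : ℝ} (ha : 0 < a) :
    ∃ b, 0 < b ∧ Real.exp (-a) * (1 + a) = Real.exp (-(2 * b)) * (1 + b) := by
  have hc : ContinuousOn (fun b : ℝ => Real.exp (-(2 * b)) * (1 + b)) (Icc 0 a) := by fun_prop
  have h0 : Real.exp (-a) * (1 + a) < 1 := by
    simpa using exp_neg_mul_one_add_lt le_rfl ha
  have hle : Real.exp (-(2 * a)) * (1 + a) ≤ Real.exp (-a) * (1 + a) := by
    gcongr; linarith
  obtain ⟨b, hb, hb'⟩ := intermediate_value_Icc' ha.le hc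
    (show Real.exp (-a) * (1 + a) ∈ Icc _ _ from ⟨hle, by simpa using h0.le⟩)
  refine ⟨b, lt_of_le_of_ne hb.1 ?_, hb'.symm⟩
  rintro rfl
  simp at hb'
  linarith

/-! ### Numerical location of the crossing -/

lemma exp_le_of_taylor {x : ℝ} (h0 : 0 ≤ x) (h1 : x ≤ 1) :
    Real.exp x ≤ ∑ m ∈ Finset.range 8, x ^ m / m.factorial
      + x ^ 8 * (8 + 1) / (Nat.factorial 8 * 8) := by
  exact_mod_cast Real.exp_bound' h0 h1 (n := 8) (by norm_num)

lemma taylor_le_exp {x : ℝ} (h0 : 0 ≤ x) :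
    ∑ m ∈ Finset.range 9, x ^ m / m.factorial ≤ Real.exp x :=
  Real.sum_le_exp_of_nonneg h0 9

/-- The second curve, solved for `α`. -/
noncomputable def secondCurve (b : ℝ) : ℝ := 1 / ((3 / 2 + b) * Real.exp b / (1 + b) - 1) - 1

lemma secondCurve_denom_pos {b : ℝ} (hb : 0 ≤ b) :
    0 < (3 / 2 + b) * Real.exp b / (1 + b) - 1 := by
  rw [sub_pos, lt_div_iff₀ (by positivity)]
  nlinarith [Real.one_le_exp hb]

lemma continuousOn_secondCurve : ContinuousOn secondCurve (Ici 0) := by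
  unfold secondCurve
  refine ContinuousOn.sub (ContinuousOn.div continuousOn_const ?_ ?_) continuousOn_const
  · refine ContinuousOn.sub (ContinuousOn.div (by fun_prop) (by fun_prop) ?_) continuousOn_const
    intro b hb
    have : (0 : ℝ) ≤ b := hb
    positivity
  · intro b hb
    exact (secondCurve_denom_pos hb).ne'

/-- `secondCurve` solves the quotient of the two crossing equations, `1 + 1/(1+α) =
(3/2+β)e^β/(1+β)`. On its graph the first equation therefore implies the second. -/
lemma secondCurve_spec {b : ℝ} (hb : 0 ≤ b) (h : 0 < 1 + secondCurve b)
    (h' : Real.exp (-(secondCurve b)) * (1 + secondCurve b) = Real.exp (-(2 * b)) * (1 + b)) :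
    Real.exp (-(secondCurve b)) * (1 + secondCurve b / 2) = Real.exp (-b) * (3 / 4 + b / 2) := by
  have hd := secondCurve_denom_pos hb
  set a := secondCurve b with ha
  have h1 : (1 + a) * ((3 / 2 + b) * Real.exp b / (1 + b) - 1) = 1 := by
    have e : 1 + a = 1 / ((3 / 2 + b) * Real.exp b / (1 + b) - 1) := by
      rw [ha, secondCurve]; ring
    rw [e, one_div_mul_cancel hd.ne']
  have h2 : (1 + a) * (3 / 2 + b) * Real.exp b = (2 + a) * (1 + b) := by
    field_simp at h1; linarith
  have e1 : Real.exp (-b) * Real.exp b = 1 := by rw [← Real.exp_add]; simp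
  have e2 : Real.exp (-(2 * b)) = Real.exp (-b) * Real.exp (-b) := by
    rw [← Real.exp_add]; ring_nf
  apply mul_right_cancel₀ h.ne'
  calc _ = Real.exp (-a) * (1 + a) * (1 + a / 2) := by ring
    _ = Real.exp (-b) * Real.exp (-b) * ((2 + a) * (1 + b)) / 2 := by rw [h', e2]; ring
    _ = Real.exp (-b) * (Real.exp (-b) * Real.exp b) * ((1 + a) * (3 / 2 + b)) / 2 := by
      rw [← h2]; ring
    _ = _ := by rw [e1]; ring

lemma secondCurve_anti {b b' : ℝ} (hb : 0 ≤ b) (hbb : b ≤ b') : secondCurve b' ≤ secondCurve b := by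
  unfold secondCurve
  have hd := secondCurve_denom_pos hb
  have hb' := hb.trans hbb
  gcongr ?_ - 1
  apply one_div_le_one_div_of_le hd
  gcongr ?_ - 1
  have he : (b' - b) + 1 ≤ Real.exp (b' - b) := Real.add_one_le_exp _
  have h1 : Real.exp b' = Real.exp b * Real.exp (b' - b) := by rw [← Real.exp_add]; ring_nf
  rw [div_le_div_iff₀ (by positivity) (by positivity), h1]
  have hp := Real.exp_pos b
  have h3 : (3 / 2 + b) * (1 + b') ≤ (3 / 2 + b') * (1 + b) * Real.exp (b' - b) := by
    have : (3 / 2 + b') * (1 + b) * (1 + (b' - b)) ≤ (3 / 2 + b') * (1 + b) * Real.exp (b' - b) := by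
      gcongr; linarith
    nlinarith [mul_nonneg (sub_nonneg.2 hbb) hb, mul_nonneg (sub_nonneg.2 hbb) hb',
      mul_nonneg (mul_nonneg (sub_nonneg.2 hbb) hb) hb']
  nlinarith

lemma secondCurve_le {b a : ℝ} (hb : 0 ≤ b)
    (h : (2 + a) * (1 + b) ≤ (1 + a) * (3 / 2 + b) * Real.exp b) : secondCurve b ≤ a := by
  unfold secondCurve
  have hd := secondCurve_denom_pos hb
  rw [sub_le_iff_le_add, div_le_iff₀ hd]
  have : (2 + a) ≤ (1 + a) * ((3 / 2 + b) * Real.exp b / (1 + b)) := by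
    rw [← mul_div_assoc, le_div_iff₀ (by positivity)]; linarith
  linarith

lemma le_secondCurve {b a : ℝ} (hb : 0 ≤ b)
    (h : (1 + a) * (3 / 2 + b) * Real.exp b ≤ (2 + a) * (1 + b)) : a ≤ secondCurve b := by
  unfold secondCurve
  have hd := secondCurve_denom_pos hb
  rw [le_sub_iff_add_le, le_div_iff₀ hd]
  have : (1 + a) * ((3 / 2 + b) * Real.exp b / (1 + b)) ≤ 2 + a := by
    rw [← mul_div_assoc, div_le_iff₀ (by positivity)]; linarith
  linarith

/-- Along the graph of `secondCurve`, the difference of the two sides of the first equation changes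
sign between `β = 0.11895` and `β = 0.11906`. The bounds `u1` and `l2`, with monotonicity of
`secondCurve`, then enclose `α`. -/
lemma exists_crossing :
    ∃ a b : ℝ, 0.5879 ≤ a ∧ a ≤ 0.5884 ∧ (a, b) ∈ crossing := by
  have l1 : (0.5882 : ℝ) ≤ secondCurve 0.11895 := by
    apply le_secondCurve (by norm_num)
    have := exp_le_of_taylor (x := 0.11895) (by norm_num) (by norm_num)
    norm_num [Finset.sum_range_succ, Nat.factorial] at this ⊢
    linarith
  have u1 : secondCurve 0.11895 ≤ 0.5884 := by
    apply secondCurve_le (by norm_num)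
    have := taylor_le_exp (x := 0.11895) (by norm_num)
    norm_num [Finset.sum_range_succ, Nat.factorial] at this ⊢
    linarith
  have l2 : (0.5879 : ℝ) ≤ secondCurve 0.11906 := by
    apply le_secondCurve (by norm_num)
    have := exp_le_of_taylor (x := 0.11906) (by norm_num) (by norm_num)
    norm_num [Finset.sum_range_succ, Nat.factorial] at this ⊢
    linarith
  have u2 : secondCurve 0.11906 ≤ 0.5881 := by
    apply secondCurve_le (by norm_num)
    have := taylor_le_exp (x := 0.11906) (by norm_num)
    norm_num [Finset.sum_range_succ, Nat.factorial] at this ⊢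
    linarith
  have anti : ∀ {s t : ℝ}, 0 ≤ s → s ≤ t →
      Real.exp (-t) * (1 + t) ≤ Real.exp (-s) * (1 + s) := by
    intro s t hs hst
    rcases hst.eq_or_lt with rfl | h
    · exact le_rfl
    · exact (exp_neg_mul_one_add_lt hs h).le
  have n1 : Real.exp (-0.5882) * (1 + 0.5882) ≤ Real.exp (-(2 * 0.11895)) * (1 + 0.11895) := by
    have e : Real.exp (-(2 * 0.11895)) = Real.exp (-0.5882) * Real.exp 0.3503 := by
      rw [← Real.exp_add]; norm_num
    rw [e, mul_assoc]
    apply mul_le_mul_of_nonneg_left _ (Real.exp_pos _).le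
    have := taylor_le_exp (x := 0.3503) (by norm_num)
    norm_num [Finset.sum_range_succ, Nat.factorial] at this ⊢
    linarith
  have n2 : Real.exp (-(2 * 0.11906)) * (1 + 0.11906) ≤ Real.exp (-0.5881) * (1 + 0.5881) := by
    have e : Real.exp (-(2 * 0.11906)) = Real.exp (-0.5881) * Real.exp 0.34998 := by
      rw [← Real.exp_add]; norm_num
    rw [e, mul_assoc]
    apply mul_le_mul_of_nonneg_left _ (Real.exp_pos _).le
    have := exp_le_of_taylor (x := 0.34998) (by norm_num) (by norm_num)
    norm_num [Finset.sum_range_succ, Nat.factorial] at this ⊢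
    linarith
  let φ : ℝ → ℝ := fun b => Real.exp (-(secondCurve b)) * (1 + secondCurve b)
    - Real.exp (-(2 * b)) * (1 + b)
  have hφ : ContinuousOn φ (Icc 0.11895 0.11906) := by
    have hs : ContinuousOn secondCurve (Icc 0.11895 0.11906) :=
      continuousOn_secondCurve.mono fun t ht => le_trans (by norm_num) ht.1
    exact (hs.neg.rexp.mul (hs.const_add 1)).sub (by fun_prop)
  have hzero : (0 : ℝ) ∈ Icc (φ 0.11895) (φ 0.11906) := by
    constructor
    · have := anti (by norm_num) l1
      simp only [φ]; linarith
    · have := anti (by linarith) u2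
      simp only [φ]; linarith
  obtain ⟨b, hb, hb0⟩ := intermediate_value_Icc (by norm_num) hφ hzero
  have hb' : 0 < b := lt_of_lt_of_le (by norm_num) hb.1
  have hlo := l2.trans (secondCurve_anti hb'.le hb.2)
  have hhi := (secondCurve_anti (by norm_num) hb.1).trans u1
  have hcurve := sub_eq_zero.1 hb0
  exact ⟨secondCurve b, b, hlo, hhi, by simp only; linarith, hb', hcurve,
    secondCurve_spec hb'.le (by linarith) hcurve⟩

lemma crossing_subsingleton {p q : ℝ × ℝ} (hp : p ∈ crossing) (hq : q ∈ crossing) : p = q := by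
  obtain ⟨a, b⟩ := p
  obtain ⟨a', b'⟩ := q
  obtain ⟨ha, hb, h1, h2⟩ := hp
  obtain ⟨ha', hb', h1', h2'⟩ := hq
  simp only at ha hb h1 h2 ha' hb' h1' h2'
  have hab : a = a' := by
    rcases lt_trichotomy a a' with h | h | h
    · exact absurd h2' (curve_lt_of_curve_le ha hb hb' h1 h1' h h2.le).ne
    · exact h
    · exact absurd h2 (curve_lt_of_curve_le ha' hb' hb h1' h1 h h2'.le).ne
  subst hab
  have hbb : b = b' := by
    rcases lt_trichotomy b b' with h | h | h
    · linarith [exp_neg_two_mul_one_add_lt hb.le h]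
    · exact h
    · linarith [exp_neg_two_mul_one_add_lt hb'.le h]
  rw [hbb]

/-! ### The function `c` -/

/-- On `(0, 1]` the numerator is nonpositive and increasing, so a larger denominator only helps.
From `1` on, `c` is nonnegative, so its decrease past the maximum does no harm. -/
lemma cFun_le_cFun {a b : ℝ} (ha : 0 < a) (ha1 : a ≤ 1) (hab : a ≤ b) : cFun a ≤ cFun b := by
  unfold cFun
  have hb := ha.trans_le hab
  have hla : Real.log ((1 + a) / 2) ≤ 0 := Real.log_nonpos (by positivity) (by linarith)
  rcases le_total 1 b with h | h
  · exact (div_nonpos_of_nonpos_of_nonneg hla ha.le).trans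
      (div_nonneg (Real.log_nonneg (by linarith)) hb.le)
  · have hlb : Real.log ((1 + b) / 2) ≤ 0 := Real.log_nonpos (by positivity) (by linarith)
    have hlab : Real.log ((1 + a) / 2) ≤ Real.log ((1 + b) / 2) :=
      Real.log_le_log (by positivity) (by linarith)
    rw [div_le_div_iff₀ ha hb]
    nlinarith

/-- At the critical point `s` the tangent to `ln((1+a)/2)` passes through the origin. By concavity
of the logarithm, `ln((1+a)/2) ≤ a/(1+s)` for all `a > 0`, so `c ≤ 1/(1+s) = c(s)`. -/
lemma exists_isGreatest_cFun : ∃ c, IsGreatest (cFun '' Ioi 0) c := by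
  let φ : ℝ → ℝ := fun s => Real.log ((1 + s) / 2) * (1 + s) - s
  have hφ : ContinuousOn φ (Icc 3 4) := by
    refine ContinuousOn.sub (ContinuousOn.mul (ContinuousOn.log (by fun_prop) ?_) (by fun_prop))
      (by fun_prop)
    intro s hs
    have := hs.1
    positivity
  have h0 : (0 : ℝ) ∈ Icc (φ 3) (φ 4) := by
    constructor
    · have := Real.log_two_lt_d9
      simp only [φ]; norm_num at this ⊢; linarith
    · have h : (0.8 : ℝ) ≤ Real.log ((1 + 4) / 2) := by
        rw [Real.le_log_iff_exp_le (by norm_num)]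
        have := exp_le_of_taylor (x := 0.8) (by norm_num) (by norm_num)
        norm_num [Finset.sum_range_succ, Nat.factorial] at this ⊢
        linarith
      simp only [φ]; linarith
  obtain ⟨s, hs, hs0⟩ := intermediate_value_Icc (by norm_num) hφ h0
  have hs3 : (3 : ℝ) ≤ s := hs.1
  have hlog : Real.log ((1 + s) / 2) = s / (1 + s) := by
    rw [eq_div_iff (by positivity)]; exact sub_eq_zero.1 hs0
  refine ⟨cFun s, ⟨s, by simp only [mem_Ioi]; linarith, rfl⟩, ?_⟩
  rintro _ ⟨a, ha, rfl⟩
  have ha : 0 < a := ha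
  have hle : Real.log ((1 + a) / 2) ≤ a / (1 + s) := by
    have h1 := Real.log_le_sub_one_of_pos (show 0 < (1 + a) / (1 + s) by positivity)
    have h2 : Real.log ((1 + a) / 2) = Real.log ((1 + a) / (1 + s)) + Real.log ((1 + s) / 2) := by
      rw [← Real.log_mul (by positivity) (by positivity)]
      congr 1
      field_simp
    have h3 : (1 + a) / (1 + s) - 1 + s / (1 + s) = a / (1 + s) := by field_simp; ring
    linarith
  unfold cFun
  rw [hlog, div_div, div_le_div_iff₀ ha (by positivity)]
  calc _ ≤ a / (1 + s) * ((1 + s) * s) := by gcongr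
    _ = _ := by field_simp

lemma abs_isGreatest_cFun_sub_le {c : ℝ} (hc : IsGreatest (cFun '' Ioi 0) c) :
    |c - 0.232| ≤ 0.0005 := by
  have hlow : (0.2315 : ℝ) ≤ c := by
    -- `3.3` is close to the maximizer.
    refine le_trans ?_ (hc.2 ⟨3.3, by simp only [mem_Ioi]; norm_num, rfl⟩)
    rw [cFun, le_div_iff₀ (by norm_num), Real.le_log_iff_exp_le (by norm_num)]
    have := exp_le_of_taylor (x := 0.2315 * 3.3) (by norm_num) (by norm_num)
    norm_num [Finset.sum_range_succ, Nat.factorial] at this ⊢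
    linarith
  have hup : c ≤ 0.2325 := by
    obtain ⟨a, ha, rfl⟩ := hc.1
    have ha : 0 < a := ha
    rw [cFun, div_le_iff₀ ha]
    -- Tangent line of slope `0.2325` to the logarithm. The constant terms cancel because `0.7675 =
    -- 1 - 0.2325`.
    have h1 := Real.log_le_sub_one_of_pos (show 0 < 0.2325 * (1 + a) by positivity)
    have h2 : Real.log ((1 + a) / 2) = Real.log (0.2325 * (1 + a)) + Real.log (1 / 0.465) := by
      rw [← Real.log_mul (by positivity) (by positivity)]
      congr 1
      norm_num; ring
    have h3 : Real.log (1 / 0.465) ≤ 0.7675 := by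
      rw [Real.log_le_iff_le_exp (by norm_num)]
      have := taylor_le_exp (x := 0.7675) (by norm_num)
      norm_num [Finset.sum_range_succ, Nat.factorial] at this ⊢
      linarith
    linarith
  rw [abs_le]; constructor <;> linarith

lemma abs_cFun_sub_le {a : ℝ} (hlo : 0.5879 ≤ a) (hhi : a ≤ 0.5884) :
    |cFun a - (-0.392)| ≤ 0.0005 := by
  have h1 : -0.3925 ≤ cFun a := by
    refine le_trans ?_ (cFun_le_cFun (by norm_num) (by norm_num) hlo)
    rw [cFun, le_div_iff₀ (by norm_num), Real.le_log_iff_exp_le (by norm_num),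
      show (-0.3925 * 0.5879 : ℝ) = -(0.3925 * 0.5879) by ring, Real.exp_neg,
      inv_le_comm₀ (Real.exp_pos _) (by norm_num)]
    have := taylor_le_exp (x := 0.3925 * 0.5879) (by norm_num)
    norm_num [Finset.sum_range_succ, Nat.factorial] at this ⊢
    linarith
  have h2 : cFun a ≤ -0.3915 := by
    refine (cFun_le_cFun (by linarith) (by linarith) hhi).trans ?_
    rw [cFun, div_le_iff₀ (by norm_num), Real.log_le_iff_le_exp (by norm_num),
      show (-0.3915 * 0.5884 : ℝ) = -(0.3915 * 0.5884) by ring, Real.exp_neg,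
      le_inv_comm₀ (by norm_num) (Real.exp_pos _)]
    have := exp_le_of_taylor (x := 0.3915 * 0.5884) (by norm_num) (by norm_num)
    norm_num [Finset.sum_range_succ, Nat.factorial] at this ⊢
    linarith
  rw [abs_le]; constructor <;> linarith

/-! ### The expected market -/

/-- A random finite set of faults whose void probabilities are those of a Poisson process. -/
structure HasPoissonVoids {Ω : Type*} [MeasurableSpace Ω] (P : Measure Ω) (lam : ℝ)
    (F : Ω → Set ℝ) : Prop where
  finite : ∀ ω, (F ω).Finite
  measurableSet_void : ∀ a b : ℝ, 0 ≤ a → a ≤ b → b ≤ 1 →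
    MeasurableSet {ω | ¬ (F ω ∩ Icc a b).Nonempty}
  void_prob : ∀ a b : ℝ, 0 ≤ a → a ≤ b → b ≤ 1 →
    P.real {ω | ¬ (F ω ∩ Icc a b).Nonempty} = Real.exp (-(lam * (b - a)))

section

variable {Ω : Type*} [MeasurableSpace Ω] {P : Measure Ω} {lam : ℝ} {F : Ω → Set ℝ}

lemma IsPoissonFaults.hasPoissonVoids (hF : IsPoissonFaults P lam F) : HasPoissonVoids P lam F := by
  have e : ∀ a b : ℝ, {ω | ¬ (F ω ∩ Icc a b).Nonempty} = {ω | faultCount (F ω) a b = 0} := by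
    intro a b
    ext ω
    simp only [mem_ofPred_eq, faultCount, not_nonempty_iff_eq_empty]
    rw [ncard_eq_zero ((hF.finite ω).inter_of_left _)]
  refine ⟨hF.finite, fun a b h0 hab h1 => ?_, fun a b h0 hab h1 => ?_⟩
  · rw [e]
    exact hF.measurable_count a b h0 hab h1 (measurableSet_singleton 0)
  · rw [e, hF.count_law a b h0 hab h1 0]
    simp

lemma reflect_inter_Icc (S : Set ℝ) (a b : ℝ) :
    (fun t => 1 - t) '' (S ∩ Icc a b) = ((fun t => 1 - t) '' S) ∩ Icc (1 - b) (1 - a) := by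
  rw [image_inter (fun s t h => by simpa using h)]
  simp

/-- Void probabilities are invariant under `t ↦ 1 - t`, so left half-markets reduce to right ones.
-/
lemma HasPoissonVoids.reflect (hF : HasPoissonVoids P lam F) :
    HasPoissonVoids P lam (fun ω => (fun t => 1 - t) '' F ω) := by
  have e : ∀ (a b : ℝ) ω, (((fun t => 1 - t) '' F ω) ∩ Icc a b).Nonempty ↔
      (F ω ∩ Icc (1 - b) (1 - a)).Nonempty := by
    intro a b ω
    have := reflect_inter_Icc (F ω) (1 - b) (1 - a)
    simp only [sub_sub_cancel] at this
    rw [← this, image_nonempty]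
  refine ⟨fun ω => (hF.finite ω).image _, fun a b h0 hab h1 => ?_, fun a b h0 hab h1 => ?_⟩
  · simp only [e]
    exact hF.measurableSet_void _ _ (by linarith) (by linarith) (by linarith)
  · simp only [e]
    rw [hF.void_prob _ _ (by linarith) (by linarith) (by linarith)]
    ring_nf

lemma rightEnd_mem_Icc {S : Set ℝ} (hS : S.Finite) {a b : ℝ} (hab : a ≤ b) :
    rightEnd S a b b ∈ Icc a b := by
  unfold rightEnd
  split_ifs with h
  · exact (h.csInf_mem (hS.inter_of_left _)).2
  · exact ⟨hab, le_rfl⟩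

/-- Tail events of the market end are void events, which gives both its measurability and its law.
-/
lemma lt_rightEnd_iff {S : Set ℝ} (hS : S.Finite) {a b t : ℝ} (htb : t < b) :
    t < rightEnd S a b b ↔ ¬ (S ∩ Icc a t).Nonempty := by
  have hfin := hS.inter_of_left (Icc a b)
  constructor
  · rintro h ⟨s, hs, hs'⟩
    have hsm : s ∈ S ∩ Icc a b := ⟨hs, hs'.1, hs'.2.trans htb.le⟩
    rw [rightEnd, if_pos ⟨s, hsm⟩] at h
    exact absurd (csInf_le hfin.bddBelow hsm) (not_le.2 (hs'.2.trans_lt h))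
  · intro h
    unfold rightEnd
    split_ifs with hne
    · by_contra hcon
      have hm := hne.csInf_mem hfin
      exact h ⟨_, hm.1, hm.2.1, not_lt.1 hcon⟩
    · exact htb

lemma rightEnd_eq (S : Set ℝ) (a b e : ℝ) :
    rightEnd S a b e = rightEnd S a b b
      + (e - b) * indicator {S : Set ℝ | ¬ (S ∩ Icc a b).Nonempty} 1 S := by
  unfold rightEnd
  by_cases h : (S ∩ Icc a b).Nonempty
  · rw [if_pos h, if_pos h, indicator_of_notMem (by simpa using h)]; simp
  · rw [if_neg h, if_neg h, indicator_of_mem (by simpa using h)]; simp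

lemma measurable_rightEnd_self (hF : HasPoissonVoids P lam F) {a b : ℝ} (h0 : 0 ≤ a)
    (hab : a ≤ b) (h1 : b ≤ 1) : Measurable fun ω => rightEnd (F ω) a b b := by
  refine measurable_of_Ioi fun t => ?_
  rcases lt_or_ge t b with htb | htb
  · rcases lt_or_ge t a with hta | hta
    · convert MeasurableSet.univ
      ext ω
      simpa using hta.trans_le (rightEnd_mem_Icc (hF.finite ω) hab).1
    · convert hF.measurableSet_void a t h0 hta (htb.le.trans h1)
      ext ω
      exact lt_rightEnd_iff (hF.finite ω) htb
  · convert MeasurableSet.empty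
    ext ω
    simpa using (rightEnd_mem_Icc (hF.finite ω) hab).2.trans htb

variable [IsProbabilityMeasure P]

lemma integrable_rightEnd_self (hF : HasPoissonVoids P lam F) {a b : ℝ} (h0 : 0 ≤ a)
    (hab : a ≤ b) (h1 : b ≤ 1) : Integrable (fun ω => rightEnd (F ω) a b b) P := by
  refine Integrable.of_bound (measurable_rightEnd_self hF h0 hab h1).aestronglyMeasurable 1
    (Filter.Eventually.of_forall fun ω => ?_)
  have := rightEnd_mem_Icc (hF.finite ω) hab
  rw [Real.norm_eq_abs, abs_le]
  constructor <;> linarith [this.1, this.2]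

/-- Layer-cake formula: the mean of the end minus `a` is the integral of the void probability
`e^{-λt}` over `[0, b-a]`. -/
lemma integral_rightEnd_self (hlam : 0 < lam) (hF : HasPoissonVoids P lam F) {a b : ℝ} (h0 : 0 ≤ a)
    (hab : a ≤ b) (h1 : b ≤ 1) :
    ∫ ω, rightEnd (F ω) a b b ∂P = a + (1 - Real.exp (-(lam * (b - a)))) / lam := by
  have hint := integrable_rightEnd_self hF h0 hab h1
  have hi : Integrable (fun ω => rightEnd (F ω) a b b - a) P := hint.sub (integrable_const a)
  have hnn : 0 ≤ᵐ[P] fun ω => rightEnd (F ω) a b b - a :=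
    Filter.Eventually.of_forall fun ω => sub_nonneg.2 (rightEnd_mem_Icc (hF.finite ω) hab).1
  have key := hi.integral_eq_integral_meas_lt hnn
  rw [integral_sub hint (integrable_const a)] at key
  simp only [integral_const, probReal_univ, one_smul] at key
  have e1 : ∫ t in Ioi (0 : ℝ), P.real {ω | t < rightEnd (F ω) a b b - a}
      = ∫ t in Ioo (0 : ℝ) (b - a), P.real {ω | t < rightEnd (F ω) a b b - a} := by
    refine setIntegral_eq_of_subset_of_forall_sdiff_eq_zero measurableSet_Ioi
      (fun t ht => ht.1) fun t ht => ?_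
    have hle : b - a ≤ t := by
      by_contra hcon
      exact ht.2 ⟨ht.1, not_le.1 hcon⟩
    have : {ω | t < rightEnd (F ω) a b b - a} = ∅ := by
      ext ω
      simp only [mem_ofPred_eq, mem_empty_iff_false, iff_false, not_lt]
      linarith [(rightEnd_mem_Icc (hF.finite ω) hab).2]
    rw [this, measureReal_empty]
  have e2 : ∫ t in Ioo (0 : ℝ) (b - a), P.real {ω | t < rightEnd (F ω) a b b - a}
      = ∫ t in Ioo (0 : ℝ) (b - a), Real.exp (-(lam * t)) := by
    refine setIntegral_congr_fun measurableSet_Ioo fun t ht => ?_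
    have : {ω | t < rightEnd (F ω) a b b - a} = {ω | ¬ (F ω ∩ Icc a (a + t)).Nonempty} := by
      ext ω
      rw [mem_ofPred_eq, mem_ofPred_eq, ← lt_rightEnd_iff (hF.finite ω) (by linarith [ht.2] : a + t < b)]
      constructor <;> intro h <;> linarith
    simp only [this]
    rw [hF.void_prob a (a + t) h0 (by linarith [ht.1]) (by linarith [ht.2])]
    ring_nf
  have e3 : ∫ t in Ioo (0 : ℝ) (b - a), Real.exp (-(lam * t))
      = (1 - Real.exp (-(lam * (b - a)))) / lam := by
    rw [← integral_Ioc_eq_integral_Ioo, ← intervalIntegral.integral_of_le (sub_nonneg.2 hab)]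
    have hd : ∀ t ∈ uIcc 0 (b - a),
        HasDerivAt (fun t : ℝ => -(Real.exp (-(lam * t)) / lam)) (Real.exp (-(lam * t))) t := by
      intro t _
      have h2 : HasDerivAt (fun t : ℝ => -(lam * t)) (-(lam * 1)) t :=
        ((hasDerivAt_id t).const_mul lam).neg
      refine (h2.exp.div_const lam).neg.congr_deriv ?_
      field_simp
    rw [intervalIntegral.integral_eq_sub_of_hasDerivAt hd
      (Continuous.intervalIntegrable (by fun_prop) _ _)]
    simp
    ring
  rw [e1, e2, e3] at key
  linarith

/-- The choice `e = (a+b)/2` produces `neighborHalf`, and `e = b` produces `peripheralHalf`. -/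
lemma integrable_and_integral_rightEnd (hlam : 0 < lam) (hF : HasPoissonVoids P lam F) {a b : ℝ}
    (e : ℝ) (h0 : 0 ≤ a) (hab : a ≤ b) (h1 : b ≤ 1) :
    Integrable (fun ω => rightEnd (F ω) a b e) P ∧
    ∫ ω, rightEnd (F ω) a b e ∂P = a + (1 - Real.exp (-(lam * (b - a)))) / lam
      + (e - b) * Real.exp (-(lam * (b - a))) := by
  have hm := hF.measurableSet_void a b h0 hab h1
  have hfun : (fun ω => rightEnd (F ω) a b e) = fun ω => rightEnd (F ω) a b b
      + (e - b) * indicator {ω | ¬ (F ω ∩ Icc a b).Nonempty} (fun _ => (1 : ℝ)) ω := by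
    funext ω
    rw [rightEnd_eq]
    rfl
  have hi := integrable_rightEnd_self hF h0 hab h1
  have hi2 : Integrable (fun ω => (e - b) *
      indicator {ω | ¬ (F ω ∩ Icc a b).Nonempty} (fun _ => (1 : ℝ)) ω) P :=
    ((integrable_const (1 : ℝ)).indicator hm).const_mul _
  rw [hfun]
  refine ⟨hi.add hi2, ?_⟩
  rw [integral_add hi hi2, integral_rightEnd_self hlam hF h0 hab h1, integral_const_mul,
    integral_indicator_const _ hm, hF.void_prob a b h0 hab h1, smul_eq_mul, mul_one]

/-! ### The payoff in closed form -/

open Classical in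
/-- The expected right half-market, in units of the mean distance between faults, of a server
at `p` in presence of the occupied locations `S`. -/
noncomputable def rightValue (lam : ℝ) (S : Set ℝ) (p : ℝ) : ℝ :=
  if (S ∩ Ioi p).Nonempty then neighborHalf (lam * (sInf (S ∩ Ioi p) - p))
  else peripheralHalf (lam * (1 - p))

/-- The expected left half-market, obtained by reflection. -/
noncomputable def leftValue (lam : ℝ) (S : Set ℝ) (p : ℝ) : ℝ :=
  rightValue lam ((fun t => 1 - t) '' S) (1 - p)

/-- The payoff of server `i` in closed form, in units of the mean distance between faults. -/
noncomputable def value (lam : ℝ) {n : ℕ} (x : Fin n → ℝ) (i : Fin n) : ℝ :=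
  (rightValue lam (range x) (x i) + leftValue lam (range x) (x i)) /
    (({j | x j = x i} : Set (Fin n)).ncard : ℝ)

lemma integrable_and_integral_marketRight (hlam : 0 < lam) (hF : HasPoissonVoids P lam F) {n : ℕ}
    {x : Fin n → ℝ} (hx : ∀ i, x i ∈ Icc (0 : ℝ) 1) (i : Fin n) :
    Integrable (fun ω => marketRight (F ω) x i) P ∧
    ∫ ω, marketRight (F ω) x i ∂P = x i + rightValue lam (range x) (x i) / lam := by
  unfold marketRight rightValue rightNeighbor
  by_cases h : (locsRight x i).Nonempty
  · have hfin : (locsRight x i).Finite := (finite_range x).inter_of_left _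
    have hmem := h.csInf_mem hfin
    obtain ⟨⟨j, hj⟩, hgt⟩ := hmem
    have hle : x i ≤ sInf (locsRight x i) := le_of_lt hgt
    have h1 : sInf (locsRight x i) ≤ 1 := hj ▸ (hx j).2
    simp only [if_pos h]
    rw [if_pos (show (range x ∩ Ioi (x i)).Nonempty from h)]
    refine ⟨(integrable_and_integral_rightEnd hlam hF _ (hx i).1 hle h1).1, ?_⟩
    rw [(integrable_and_integral_rightEnd hlam hF _ (hx i).1 hle h1).2]
    change _ = x i + neighborHalf (lam * (sInf (locsRight x i) - x i)) / lam
    unfold neighborHalf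
    field_simp
    ring
  · simp only [if_neg h]
    rw [if_neg (show ¬ (range x ∩ Ioi (x i)).Nonempty from h)]
    refine ⟨(integrable_and_integral_rightEnd hlam hF _ (hx i).1 (hx i).2 le_rfl).1, ?_⟩
    rw [(integrable_and_integral_rightEnd hlam hF _ (hx i).1 (hx i).2 le_rfl).2]
    unfold peripheralHalf
    ring

lemma reflect_range {n : ℕ} (x : Fin n → ℝ) :
    (fun t => 1 - t) '' range x = range fun k => 1 - x k := by
  rw [← range_comp]; rfl

lemma sInf_reflect {S : Set ℝ} (hS : S.Finite) (hne : S.Nonempty) :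
    sInf ((fun t => 1 - t) '' S) = 1 - sSup S := by
  have hg : IsGreatest S (sSup S) := ⟨hne.csSup_mem hS, fun s hs => le_csSup hS.bddAbove hs⟩
  refine IsLeast.csInf_eq ⟨⟨_, hg.1, rfl⟩, ?_⟩
  rintro _ ⟨s, hs, rfl⟩
  have := hg.2 hs
  simp only
  linarith

lemma leftEnd_eq_reflect {S : Set ℝ} (hS : S.Finite) (a b e : ℝ) :
    leftEnd S a b e = 1 - rightEnd ((fun t => 1 - t) '' S) (1 - b) (1 - a) (1 - e) := by
  unfold leftEnd rightEnd
  rw [← reflect_inter_Icc, image_nonempty]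
  split_ifs with h
  · rw [sInf_reflect (hS.inter_of_left _) h]; ring
  · ring

lemma locsRight_reflect {n : ℕ} (x : Fin n → ℝ) (i : Fin n) :
    locsRight (fun k => 1 - x k) i = (fun t => 1 - t) '' locsLeft x i := by
  unfold locsRight locsLeft
  rw [image_inter (fun s t h => by simpa using h), reflect_range]
  simp

lemma marketLeft_eq_reflect {S : Set ℝ} (hS : S.Finite) {n : ℕ} (x : Fin n → ℝ) (i : Fin n) :
    marketLeft S x i = 1 - marketRight ((fun t => 1 - t) '' S) (fun k => 1 - x k) i := by
  have hne : (locsRight (fun k => 1 - x k) i).Nonempty ↔ (locsLeft x i).Nonempty := by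
    rw [locsRight_reflect, image_nonempty]
  unfold marketLeft marketRight rightNeighbor leftNeighbor
  by_cases h : (locsLeft x i).Nonempty
  · have hs := sInf_reflect (S := locsLeft x i) ((finite_range x).inter_of_left _) h
    rw [if_pos h, if_pos (hne.2 h), locsRight_reflect, hs, leftEnd_eq_reflect hS]
    congr 2
    ring
  · rw [if_neg h, if_neg (hne.not.2 h), leftEnd_eq_reflect hS]
    simp

lemma payoff_eq (hlam : 0 < lam) (hF : HasPoissonVoids P lam F) {n : ℕ}
    {x : Fin n → ℝ} (hx : ∀ i, x i ∈ Icc (0 : ℝ) 1) (i : Fin n) :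
    payoff P F x i = value lam x i / lam := by
  have hR := integrable_and_integral_marketRight hlam hF hx i
  have hx' : ∀ i, 1 - x i ∈ Icc (0 : ℝ) 1 := fun i =>
    ⟨by linarith [(hx i).2], by linarith [(hx i).1]⟩
  have hL := integrable_and_integral_marketRight hlam hF.reflect hx' i
  have hfun : (fun ω => marketLeft (F ω) x i) =
      fun ω => 1 - marketRight ((fun t => 1 - t) '' F ω) (fun k => 1 - x k) i :=
    funext fun ω => marketLeft_eq_reflect (hF.finite ω) x i
  have hiL : Integrable (fun ω => marketLeft (F ω) x i) P := by
    rw [hfun]; exact (integrable_const 1).sub hL.1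
  unfold payoff value leftValue
  rw [integral_sub hR.1 hiL, hfun, integral_sub (integrable_const 1) hL.1, hR.2, hL.2,
    reflect_range]
  simp only [integral_const, probReal_univ, one_smul]
  ring

/-- The equilibrium condition for the payoffs in closed form. -/
def IsValueNash (lam : ℝ) {n : ℕ} (x : Fin n → ℝ) : Prop :=
  (∀ i, x i ∈ Icc (0 : ℝ) 1) ∧
    ∀ i, ∀ y ∈ Icc (0 : ℝ) 1, value lam (Function.update x i y) i ≤ value lam x i

lemma IsNash.isValueNash (hlam : 0 < lam) (hF : HasPoissonVoids P lam F) {n : ℕ}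
    {x : Fin n → ℝ} (hx : IsNash P F x) : IsValueNash lam x := by
  refine ⟨hx.1, fun i y hy => ?_⟩
  have h := hx.2 i y hy
  rw [payoff_eq hlam hF hx.1, payoff_eq hlam hF, div_le_div_iff_of_pos_right hlam] at h
  · exact h
  · intro k
    rcases eq_or_ne k i with rfl | hk
    · simpa using hy
    · simpa [Function.update_of_ne hk] using hx.1 k

end

/-! ### The equilibria of the game with payoffs in closed form -/

section

variable {lam : ℝ} {S : Set ℝ} {p : ℝ}

lemma rightValue_of_neighbor {r : ℝ} (hr : r ∈ S) (hpr : p < r) (hS : ∀ s ∈ S, s ≤ p ∨ r ≤ s) :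
    rightValue lam S p = neighborHalf (lam * (r - p)) := by
  have hl : IsLeast (S ∩ Ioi p) r :=
    ⟨⟨hr, hpr⟩, fun s hs => (hS s hs.1).resolve_left (not_le.2 hs.2)⟩
  rw [rightValue, if_pos ⟨r, hr, hpr⟩, hl.csInf_eq]

lemma rightValue_of_peripheral (hS : ∀ s ∈ S, s ≤ p) :
    rightValue lam S p = peripheralHalf (lam * (1 - p)) := by
  rw [rightValue, if_neg]
  rintro ⟨s, hs, hs'⟩
  exact absurd (hS s hs) (not_le.2 hs')

lemma leftValue_of_neighbor {l : ℝ} (hl : l ∈ S) (hlp : l < p) (hS : ∀ s ∈ S, s ≤ l ∨ p ≤ s) :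
    leftValue lam S p = neighborHalf (lam * (p - l)) := by
  rw [leftValue, rightValue_of_neighbor (r := 1 - l) (mem_image_of_mem _ hl) (by linarith)]
  · ring_nf
  · rintro _ ⟨s, hs, rfl⟩
    rcases hS s hs with h | h
    · right; linarith
    · left; linarith

lemma leftValue_of_peripheral (hS : ∀ s ∈ S, p ≤ s) :
    leftValue lam S p = peripheralHalf (lam * p) := by
  rw [leftValue, rightValue_of_peripheral]
  · ring_nf
  · rintro _ ⟨s, hs, rfl⟩
    simp only
    linarith [hS s hs]

lemma rightValue_nonneg (hlam : 0 < lam) (hp : p ≤ 1) : 0 ≤ rightValue lam S p := by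
  unfold rightValue
  split_ifs with h
  · have : p ≤ sInf (S ∩ Ioi p) := le_csInf h fun s hs => le_of_lt hs.2
    exact neighborHalf_nonneg (mul_nonneg hlam.le (sub_nonneg.2 this))
  · exact peripheralHalf_nonneg (mul_nonneg hlam.le (sub_nonneg.2 hp))

lemma leftValue_nonneg (hlam : 0 < lam) (hp : 0 ≤ p) : 0 ≤ leftValue lam S p :=
  rightValue_nonneg hlam (by linarith)

lemma rightValue_insert_self : rightValue lam (insert p S) p = rightValue lam S p := by
  have : insert p S ∩ Ioi p = S ∩ Ioi p := by
    rw [insert_inter_of_notMem (by simp)]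
  rw [rightValue, rightValue, this]

lemma leftValue_insert_self : leftValue lam (insert p S) p = leftValue lam S p := by
  rw [leftValue, leftValue, image_insert_eq, rightValue_insert_self]

end

section

variable {lam : ℝ} {n : ℕ} {x : Fin n → ℝ}

/-! ### Symmetries of the game and payoffs of deviations -/

lemma value_reflect (x : Fin n → ℝ) (i : Fin n) :
    value lam (fun k => 1 - x k) i = value lam x i := by
  unfold value leftValue
  rw [← reflect_range, image_image]
  simp only [sub_sub_cancel, image_id', sub_right_inj]
  rw [add_comm]

lemma IsValueNash.reflect (hx : IsValueNash lam x) : IsValueNash lam (fun k => 1 - x k) := by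
  refine ⟨fun i => ⟨by linarith [(hx.1 i).2], by linarith [(hx.1 i).1]⟩, fun i y hy => ?_⟩
  have h : Function.update (fun k => 1 - x k) i y = fun k => 1 - Function.update x i (1 - y) k := by
    funext k
    rcases eq_or_ne k i with rfl | hk
    · simp
    · simp [Function.update_of_ne hk]
  rw [h, value_reflect, value_reflect]
  exact hx.2 i _ ⟨by linarith [hy.2], by linarith [hy.1]⟩

lemma value_comp_perm (x : Fin n → ℝ) (σ : Equiv.Perm (Fin n)) (i : Fin n) :
    value lam (x ∘ σ) i = value lam x (σ i) := by
  have h : ({j | (x ∘ σ) j = (x ∘ σ) i} : Set (Fin n)).ncard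
      = ({j | x j = x (σ i)} : Set (Fin n)).ncard :=
    ncard_preimage_of_injective_subset_range (s := {j | x j = x (σ i)}) σ.injective (by simp)
  rw [value, value, h, σ.surjective.range_comp]
  rfl

lemma IsValueNash.comp_perm (hx : IsValueNash lam x) (σ : Equiv.Perm (Fin n)) :
    IsValueNash lam (x ∘ σ) := by
  refine ⟨fun i => hx.1 _, fun i y hy => ?_⟩
  rw [← Function.update_comp_eq_of_injective x σ.injective i y, value_comp_perm, value_comp_perm]
  exact hx.2 _ y hy

lemma value_update {i : Fin n} {y : ℝ} (hy : ∀ k, k ≠ i → x k ≠ y) :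
    value lam (Function.update x i y) i =
      rightValue lam (x '' {i}ᶜ) y + leftValue lam (x '' {i}ᶜ) y := by
  have h1 : {j | Function.update x i y j = Function.update x i y i} = ({i} : Set (Fin n)) := by
    ext j
    rcases eq_or_ne j i with rfl | hj
    · simp
    · simpa [Function.update_of_ne hj, hj] using hy j hj
  have h2 : range (Function.update x i y) = insert y (x '' {i}ᶜ) := by
    ext s
    simp only [mem_range, mem_insert_iff, mem_image, mem_compl_iff, mem_singleton_iff]
    constructor
    · rintro ⟨j, rfl⟩
      rcases eq_or_ne j i with rfl | hj
      · simp
      · exact Or.inr ⟨j, hj, by rw [Function.update_of_ne hj]⟩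
    · rintro (rfl | ⟨j, hj, rfl⟩)
      · exact ⟨i, by simp⟩
      · exact ⟨j, by rw [Function.update_of_ne hj]⟩
  rw [value, h1, h2, Function.update_self, rightValue_insert_self, leftValue_insert_self]
  simp

/-- The payoff at `y` strictly between the neighboring servers `a` and `b`. -/
lemma value_update_between {i a b : Fin n} {y : ℝ} (ha : a ≠ i) (hb : b ≠ i) (hay : x a < y)
    (hyb : y < x b) (h : ∀ k, k ≠ i → x k ≤ x a ∨ x b ≤ x k) :
    value lam (Function.update x i y) i =
      neighborHalf (lam * (x b - y)) + neighborHalf (lam * (y - x a)) := by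
  rw [value_update, rightValue_of_neighbor (r := x b) (mem_image_of_mem x hb) hyb,
    leftValue_of_neighbor (l := x a) (mem_image_of_mem x ha) hay]
  · rintro _ ⟨k, hk, rfl⟩
    exact (h k hk).imp id fun h' => hyb.le.trans h'
  · rintro _ ⟨k, hk, rfl⟩
    exact (h k hk).imp (fun h' => h'.trans hay.le) id
  · intro k hk e
    rcases h k hk with h' | h' <;> linarith

/-- The payoff at `y` to the left of all other servers. -/
lemma value_update_left {i b : Fin n} {y : ℝ} (hb : b ≠ i) (hyb : y < x b)
    (h : ∀ k, k ≠ i → x b ≤ x k) :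
    value lam (Function.update x i y) i =
      neighborHalf (lam * (x b - y)) + peripheralHalf (lam * y) := by
  rw [value_update, rightValue_of_neighbor (r := x b) (mem_image_of_mem x hb) hyb, leftValue_of_peripheral]
  · rintro _ ⟨k, hk, rfl⟩
    exact hyb.le.trans (h k hk)
  · rintro _ ⟨k, hk, rfl⟩
    exact Or.inr (h k hk)
  · intro k hk e
    linarith [h k hk]

/-- The payoff at `y` to the right of all other servers. -/
lemma value_update_right {i a : Fin n} {y : ℝ} (ha : a ≠ i) (hay : x a < y)
    (h : ∀ k, k ≠ i → x k ≤ x a) :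
    value lam (Function.update x i y) i =
      peripheralHalf (lam * (1 - y)) + neighborHalf (lam * (y - x a)) := by
  rw [value_update, leftValue_of_neighbor (l := x a) (mem_image_of_mem x ha) hay, rightValue_of_peripheral]
  · rintro _ ⟨k, hk, rfl⟩
    exact (h k hk).trans hay.le
  · rintro _ ⟨k, hk, rfl⟩
    exact Or.inl (h k hk)
  · intro k hk e
    linarith [h k hk]

lemma value_nonneg (hlam : 0 < lam) {i : Fin n} (hx : x i ∈ Icc (0 : ℝ) 1) : 0 ≤ value lam x i :=
  div_nonneg (add_nonneg (rightValue_nonneg hlam hx.2) (leftValue_nonneg hlam hx.1))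
    (Nat.cast_nonneg _)

/-- In equilibrium, a server sharing its location earns more than its right half-market if it has a
right neighbor: it could move to the midpoint. -/
lemma IsValueNash.rightValue_lt_value (hlam : 0 < lam) (hx : IsValueNash lam x) {i k : Fin n}
    (hki : k ≠ i) (hk : x k = x i) {j : Fin n} (hj : x i < x j) :
    rightValue lam (range x) (x i) < value lam x i := by
  have hne : (range x ∩ Ioi (x i)).Nonempty := ⟨x j, ⟨j, rfl⟩, hj⟩
  have hfin : (range x ∩ Ioi (x i)).Finite := (finite_range x).inter_of_left _
  obtain ⟨⟨b, hb⟩, hib⟩ := hne.csInf_mem hfin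
  have hleast : ∀ m, x m ≤ x i ∨ x b ≤ x m := fun m => by
    rcases le_or_gt (x m) (x i) with h | h
    · exact Or.inl h
    · exact Or.inr (hb ▸ csInf_le hfin.bddBelow ⟨⟨m, rfl⟩, h⟩)
  rw [← hb] at hib
  have hib : x i < x b := hib
  have hbi : b ≠ i := by rintro rfl; exact lt_irrefl _ hib
  rw [rightValue_of_neighbor (r := x b) (mem_range_self b) hib (by rintro _ ⟨m, rfl⟩; exact hleast m)]
  have hdev := hx.2 i ((x i + x b) / 2)
    ⟨by linarith [(hx.1 i).1, (hx.1 b).1], by linarith [(hx.1 i).2, (hx.1 b).2]⟩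
  -- After `i` leaves, `k` still occupies `x i` and becomes the left neighbor.
  rw [value_update_between hki hbi (by linarith) (by linarith) (fun m _ => hk ▸ hleast m), hk] at hdev
  have hgain := neighborHalf_lt_two_mul (mul_pos hlam (sub_pos.2 hib))
  rw [show lam * (x b - (x i + x b) / 2) = lam * (x b - x i) / 2 by ring,
    show lam * ((x i + x b) / 2 - x i) = lam * (x b - x i) / 2 by ring] at hdev
  linarith

/-- In equilibrium, a server sharing its location earns at least its right half-market. -/
lemma IsValueNash.rightValue_le_value (hlam : 0 < lam) (hx : IsValueNash lam x) {i k : Fin n}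
    (hki : k ≠ i) (hk : x k = x i) : rightValue lam (range x) (x i) ≤ value lam x i := by
  by_cases h : ∃ j, x i < x j
  · obtain ⟨j, hj⟩ := h
    exact (hx.rightValue_lt_value hlam hki hk hj).le
  push Not at h
  rw [rightValue_of_peripheral (by rintro _ ⟨m, rfl⟩; exact h m)]
  rcases (hx.1 i).2.eq_or_lt with h1 | h1
  · rw [h1, sub_self, mul_zero, peripheralHalf_zero]
    exact value_nonneg hlam (hx.1 i)
  -- Without a right neighbor, `i` can step slightly to the right and keep almost all of its right
  -- half-market; let the step tend to zero.
  have hcont : Continuous fun y => peripheralHalf (lam * (1 - y)) :=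
    continuous_peripheralHalf.comp (by fun_prop)
  refine le_of_tendsto (hcont.continuousWithinAt (s := Ioi (x i)) (x := x i)) ?_
  filter_upwards [Ioo_mem_nhdsGT h1] with y hy
  have hdev := hx.2 i y ⟨(hx.1 i).1.trans hy.1.le, hy.2.le⟩
  rw [value_update_right hki (hk ▸ hy.1) (fun m _ => hk ▸ h m), hk] at hdev
  linarith [neighborHalf_nonneg (mul_nonneg hlam.le (sub_nonneg.2 hy.1.le))]

/-- With at least three servers, no location is shared in equilibrium. -/
lemma IsValueNash.injective (hlam : 0 < lam) (hx : IsValueNash lam x) (hn : 3 ≤ n) :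
    Function.Injective x := by
  intro k i hk
  by_contra hki
  have hR := hx.rightValue_le_value hlam hki hk
  have hL := hx.reflect.rightValue_le_value hlam hki (by simp only [hk])
  rw [value_reflect, ← reflect_range] at hL
  change leftValue lam (range x) (x i) ≤ value lam x i at hL
  set γ := ({j | x j = x i} : Set (Fin n)).ncard with hγ
  have hγ2 : 2 ≤ γ := by
    rw [hγ, ← ncard_pair hki]
    refine ncard_le_ncard ?_ (toFinite _)
    rintro m (rfl | rfl)
    · exact hk
    · rfl
  have hγ2' : (2 : ℝ) ≤ γ := by exact_mod_cast hγ2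
  have hV : value lam x i * γ =
      rightValue lam (range x) (x i) + leftValue lam (range x) (x i) := by
    rw [value, div_mul_cancel₀]
    exact ne_of_gt (by linarith)
  have hV0 := value_nonneg hlam (hx.1 i)
  -- Both half-markets are at most the payoff `V`, yet they sum to `γV ≥ 2V`. A server elsewhere
  -- would make one of the bounds strict.
  have hall : ∀ j, x j = x i := by
    intro j
    rcases lt_trichotomy (x j) (x i) with h | h | h
    · have hL' := hx.reflect.rightValue_lt_value hlam hki (by simp only [hk]) (j := j)
        (by linarith)
      rw [value_reflect, ← reflect_range] at hL'
      change leftValue lam (range x) (x i) < value lam x i at hL'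
      nlinarith
    · exact h
    · have hR' := hx.rightValue_lt_value hlam hki hk h
      nlinarith
  have hγn : γ = n := by
    rw [hγ, show {j | x j = x i} = (univ : Set (Fin n)) from eq_univ_of_forall hall, ncard_univ,
      Nat.card_eq_fintype_card, Fintype.card_fin]
  have hγ3 : (3 : ℝ) ≤ γ := by rw [hγn]; exact_mod_cast hn
  -- Now `γV ≤ 2V` with `γ = n ≥ 3`, whereas some end of the segment lies at positive distance.
  have hVle : value lam x i ≤ 0 := by nlinarith
  rw [rightValue_of_peripheral (by rintro _ ⟨m, rfl⟩; exact (hall m).le)] at hR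
  rw [leftValue_of_peripheral (by rintro _ ⟨m, rfl⟩; exact (hall m).ge)] at hL
  rcases (hx.1 i).1.eq_or_lt with h0 | h0
  · linarith [peripheralHalf_pos (mul_pos hlam (show 0 < 1 - x i by linarith))]
  · linarith [peripheralHalf_pos (mul_pos hlam h0)]

/-- In equilibrium a server with two neighbors is located at their midpoint. -/
lemma IsValueNash.eq_midpoint (hlam : 0 < lam) (hx : IsValueNash lam x) {i a b : Fin n}
    (hai : x a < x i) (hib : x i < x b) (h : ∀ k, k ≠ i → x k ≤ x a ∨ x b ≤ x k) :
    x i = (x a + x b) / 2 := by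
  have ha : a ≠ i := by rintro rfl; exact lt_irrefl _ hai
  have hb : b ≠ i := by rintro rfl; exact lt_irrefl _ hib
  by_contra hne
  have hdev := hx.2 i ((x a + x b) / 2)
    ⟨by linarith [(hx.1 a).1, (hx.1 b).1], by linarith [(hx.1 a).2, (hx.1 b).2]⟩
  have hself := value_update_between (lam := lam) ha hb hai hib h
  rw [Function.update_eq_self] at hself
  rw [value_update_between ha hb (by linarith) (by linarith) h, hself] at hdev
  have hgain := neighborHalf_add_lt (mul_pos hlam (sub_pos.2 hib)).le
    (mul_pos hlam (sub_pos.2 hai)).le (by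
      intro e
      have := mul_left_cancel₀ hlam.ne' e
      exact hne (by linarith))
  rw [show lam * (x b - (x a + x b) / 2)
      = (lam * (x b - x i) + lam * (x i - x a)) / 2 by ring,
    show lam * ((x a + x b) / 2 - x a)
      = (lam * (x b - x i) + lam * (x i - x a)) / 2 by ring] at hdev
  linarith

/-- The optimality condition of the left peripheral server. -/
lemma IsValueNash.left_optimal (hlam : 0 < lam) (hx : IsValueNash lam x) {i b : Fin n}
    (hib : x i < x b) (h : ∀ k, k ≠ i → x b ≤ x k) :
    Real.exp (lam * (x b - x i) - lam * x i) = (1 + lam * (x b - x i)) / 2 := by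
  have hb : b ≠ i := by rintro rfl; exact lt_irrefl _ hib
  let Φ : ℝ → ℝ := fun y => neighborHalf (lam * (x b - y)) + peripheralHalf (lam * y)
  have hmax : ∀ y, 0 ≤ y → y < x b → Φ y ≤ Φ (x i) := by
    intro y h0 hy
    have hdev := hx.2 i y ⟨h0, hy.le.trans (hx.1 b).2⟩
    have hself := value_update_left (lam := lam) hb hib h
    rw [Function.update_eq_self] at hself
    rwa [value_update_left hb hy h, hself] at hdev
  -- A server at `0` would gain by moving to `x b / 2`, so the maximum is interior and the
  -- derivative vanishes there.
  have hpos : 0 < x i := by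
    refine lt_of_le_of_ne (hx.1 i).1 fun h0 => ?_
    have hb0 : 0 < x b := h0 ▸ hib
    have hdev := hmax (x b / 2) (by linarith) (by linarith)
    simp only [Φ, ← h0, sub_zero, mul_zero, peripheralHalf_zero, add_zero] at hdev
    have hgain := neighborHalf_lt_two_mul (mul_pos hlam hb0)
    have hle := neighborHalf_le_peripheralHalf (show 0 ≤ lam * (x b / 2) by positivity)
    rw [show lam * (x b - x b / 2) = lam * (x b / 2) by ring] at hdev
    rw [show lam * x b / 2 = lam * (x b / 2) by ring] at hgain
    linarith
  have hloc : IsLocalMax Φ (x i) := by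
    filter_upwards [Ioo_mem_nhds hpos hib] with y hy
    exact hmax y hy.1.le hy.2
  have hder : HasDerivAt Φ (Real.exp (-(lam * (x b - x i))) * (1 + lam * (x b - x i)) / 2
      * (lam * (-1)) + Real.exp (-(lam * x i)) * (lam * 1)) (x i) :=
    ((hasDerivAt_neighborHalf _).comp (x i) (((hasDerivAt_id (x i)).const_sub (x b)).const_mul lam)).add
      ((hasDerivAt_peripheralHalf _).comp (x i) ((hasDerivAt_id (x i)).const_mul lam))
  have hzero := hloc.hasDerivAt_eq_zero hder
  have heq : Real.exp (-(lam * x i)) =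
      Real.exp (-(lam * (x b - x i))) * (1 + lam * (x b - x i)) / 2 := by
    apply mul_right_cancel₀ hlam.ne'
    linarith
  rw [show lam * (x b - x i) - lam * x i = lam * (x b - x i) + -(lam * x i) by ring, Real.exp_add,
    heq, ← mul_div_assoc, ← mul_assoc, ← Real.exp_add]
  simp

/-! ### Equilibria are canonical -/

/-- The servers of a sorted equilibrium form an arithmetic progression. -/
lemma IsValueNash.arithmetic {N : ℕ} {x : Fin (N + 2) → ℝ} (hlam : 0 < lam)
    (hx : IsValueNash lam x) (hmono : StrictMono x) :
    ∀ k, (hk : k + 1 < N + 2) → x ⟨k + 1, hk⟩ - x ⟨k, by omega⟩ = x 1 - x 0 := by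
  intro k
  induction k with
  | zero => intro hk; rfl
  | succ k ih =>
    intro hk
    have hmid := hx.eq_midpoint hlam (i := ⟨k + 1, by omega⟩) (a := ⟨k, by omega⟩)
      (b := ⟨k + 2, hk⟩) (hmono (by simp)) (hmono (by simp)) (by
        intro m hm
        have hm' : (m : ℕ) ≠ k + 1 := fun e => hm (Fin.ext e)
        rcases lt_or_gt_of_ne hm' with h | h
        · exact Or.inl (hmono.monotone (by rw [Fin.le_def]; simp only; omega))
        · exact Or.inr (hmono.monotone (by rw [Fin.le_def]; simp only; omega)))
    have := ih (by omega)
    change x ⟨k + 2, hk⟩ - x ⟨k + 1, _⟩ = _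
    linarith

/-- `M = 0` would give `λH = ln 2`, excluded by the strict inequality `minimal`. -/
lemma IsCanonicalPair.M_pos {H M : ℝ} (hc : IsCanonicalPair n lam H M) :
    0 < M := by
  refine lt_of_le_of_ne hc.M_mem.1 fun h => ?_
  have h1 := eq_sub_log_of_exp_sub_eq (m := lam * M) (h := lam * H)
    (by rw [← mul_sub]; exact hc.optimal)
  have h2 := hc.minimal
  rw [← h, mul_zero, add_zero, one_div, Real.log_inv] at h1
  linarith

/-- A sorted equilibrium is the canonical profile. -/
lemma IsValueNash.eq_canonical {N : ℕ} {x : Fin (N + 2) → ℝ} {H M : ℝ} (hlam : 0 < lam)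
    (hx : IsValueNash lam x) (hmono : StrictMono x) (hc : IsCanonicalPair (N + 2) lam H M) :
    ∀ k : Fin (N + 2), x k = H + k * M := by
  have harith := hx.arithmetic hlam hmono
  set m := x 1 - x 0 with hm
  have h01 : x 0 < x 1 := hmono (by simp)
  have hm0 : 0 < m := sub_pos.2 h01
  have hform : ∀ k (hk : k < N + 2), x ⟨k, hk⟩ = x 0 + k * m := by
    intro k
    induction k with
    | zero => intro hk; simp
    | succ k ih =>
      intro hk
      have h1 := harith k hk
      have h2 := ih (by omega)
      push_cast
      linarith
  have hlast : x (Fin.last (N + 1)) = x 0 + (N + 1) * m := by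
    have := hform (N + 1) (by omega)
    push_cast at this
    exact this
  have hprev : x ⟨N, by omega⟩ = x 0 + N * m := hform N (by omega)
  have hleft := hx.left_optimal hlam h01 (by
    intro k hk
    refine hmono.monotone ?_
    have : (k : ℕ) ≠ 0 := fun e => hk (Fin.ext e)
    rw [Fin.le_def]
    simp only [Fin.val_one]
    omega)
  have hright := hx.reflect.left_optimal hlam (i := Fin.last (N + 1)) (b := ⟨N, by omega⟩)
    (by simp only [hlast, hprev]; linarith) (by
      intro k hk
      have : (k : ℕ) ≠ N + 1 := fun e => hk (Fin.ext e)
      have hle : x k ≤ x ⟨N, by omega⟩ := hmono.monotone (by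
        rw [Fin.le_def]; simp only; omega)
      linarith)
  have e1 : 1 - x ⟨N, by omega⟩ - (1 - x (Fin.last (N + 1))) = m := by rw [hlast, hprev]; ring
  rw [e1] at hright
  have hl := eq_sub_log_of_exp_sub_eq hleft
  have hr := eq_sub_log_of_exp_sub_eq hright
  rw [← hm] at hl
  have hH := eq_sub_log_of_exp_sub_eq (m := lam * M) (h := lam * H)
    (by rw [← mul_sub]; exact hc.optimal)
  have htot := hc.total
  push_cast at htot
  have hM0 := hc.M_pos
  -- Both pairs solve `2(u - ln((1+u)/2)) + (N+1)u = λ`, with `u = λm` and `u = λM`; the left side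
  -- is strictly increasing in `u`.
  have hmM : m = M := by
    have hs : 2 * (lam * x 0) + (N + 1) * (lam * m) = 2 * (lam * H) + (N + 1) * (lam * M) := by
      have h1 : lam * x 0 = lam * (1 - x (Fin.last (N + 1))) := by rw [hl, hr]
      have h2 : 2 * x 0 + (N + 1) * m = 1 := by
        have := mul_left_cancel₀ hlam.ne' h1
        linarith
      linear_combination lam * h2 - lam * htot
    rcases lt_trichotomy m M with h | h | h
    · have h' := mul_lt_mul_of_pos_left h hlam
      have := sub_log_lt (mul_pos hlam hm0).le h'
      nlinarith [(Nat.cast_nonneg N : (0 : ℝ) ≤ N)]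
    · exact h
    · have h' := mul_lt_mul_of_pos_left h hlam
      have := sub_log_lt (mul_pos hlam hM0).le h'
      nlinarith [(Nat.cast_nonneg N : (0 : ℝ) ≤ N)]
  have hxH : x 0 = H := by
    rw [hmM, ← hH] at hl
    exact mul_left_cancel₀ hlam.ne' hl
  intro k
  rw [hform k k.2, hmM, hxH]

/-- With at least three servers in equilibrium, an interior server does not gain by becoming left
peripheral. -/
lemma IsValueNash.left_deviation_le {H M : ℝ} (hlam : 0 < lam) (hx : IsValueNash lam x)
    (hn : 3 ≤ n) (hc : IsCanonicalPair n lam H M) {t : ℝ} (ht : 0 ≤ t) (htH : t < H) :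
    neighborHalf (lam * (H - t)) + peripheralHalf (lam * t) ≤ 2 * neighborHalf (lam * M) := by
  obtain ⟨N, rfl⟩ : ∃ N, n = N + 1 + 2 := ⟨n - 3, by omega⟩
  have hinj := hx.injective hlam hn
  set z := x ∘ Tuple.sort x with hz
  have hzN : IsValueNash lam z := hx.comp_perm _
  have hzmono : StrictMono z :=
    (Tuple.monotone_sort x).strictMono_of_injective (hinj.comp (Tuple.sort x).injective)
  have hcan := hzN.eq_canonical hlam hzmono hc
  have hM0 := hc.M_pos
  let i0 : Fin (N + 1 + 2) := ⟨0, by omega⟩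
  let i1 : Fin (N + 1 + 2) := ⟨1, by omega⟩
  let i2 : Fin (N + 1 + 2) := ⟨2, by omega⟩
  have z0 : z i0 = H := by rw [hcan]; simp [i0]
  have z1 : z i1 = H + M := by rw [hcan]; simp [i1]
  have z2 : z i2 = H + 2 * M := by rw [hcan]; simp [i2]
  have h01 : i0 ≠ i1 := by simp [i0, i1]
  have h21 : i2 ≠ i1 := by simp [i1, i2]
  -- The second server deviates; the leftmost one stays at `H` and becomes its right neighbor.
  have hdev := hzN.2 i1 t ⟨ht, htH.le.trans hc.H_mem.2⟩
  have hself := value_update_between (lam := lam) (x := z) (y := z i1) h01 h21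
    (by rw [z0, z1]; linarith) (by rw [z1, z2]; linarith) (by
      intro k hk
      have : (k : ℕ) ≠ 1 := fun e => hk (Fin.ext e)
      rcases Nat.lt_or_gt_of_ne this with h | h
      · exact Or.inl (hzmono.monotone (by rw [Fin.le_def]; simp only [i0]; omega))
      · exact Or.inr (hzmono.monotone (by rw [Fin.le_def]; simp only [i2]; omega)))
  rw [Function.update_eq_self] at hself
  rw [value_update_left h01 (by rw [z0]; exact htH)
    (fun k _ => hzmono.monotone (by rw [Fin.le_def]; simp)), hself, z0, z1, z2] at hdev
  rw [show H + 2 * M - (H + M) = M by ring, show H + M - H = M by ring] at hdev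
  linarith

/-- The necessary condition for the existence of an equilibrium, on the first curve. -/
lemma IsValueNash.curve_le {H M b : ℝ} (hlam : 0 < lam) (hx : IsValueNash lam x)
    (hn : 3 ≤ n) (hc : IsCanonicalPair n lam H M) (hb : 0 < b)
    (hcurve : Real.exp (-(lam * M)) * (1 + lam * M) = Real.exp (-(2 * b)) * (1 + b)) :
    Real.exp (-(lam * M)) * (1 + lam * M / 2) ≤ Real.exp (-b) * (3 / 4 + b / 2) := by
  have ha : 0 < lam * M := mul_pos hlam (hc.M_pos)
  set a := lam * M with ha_def
  have hH := eq_sub_log_of_exp_sub_eq (m := a) (h := lam * H)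
    (by rw [ha_def, ← mul_sub]; exact hc.optimal)
  have hHb : lam * H = 2 * b - Real.log ((1 + b) / 2) := by
    have h := congrArg Real.log hcurve
    rw [Real.log_mul (Real.exp_ne_zero _) (by positivity),
      Real.log_mul (Real.exp_ne_zero _) (by positivity), Real.log_exp, Real.log_exp] at h
    rw [hH, Real.log_div (by positivity) (by norm_num), Real.log_div (by positivity) (by norm_num)]
    linarith
  -- First-order condition of the deviator: `b` is its scaled distance to the server at `H`, and `λH
  -- - b` its scaled distance to `0`.
  have hexp : Real.exp (-(lam * H - b)) = Real.exp (-b) * ((1 + b) / 2) := by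
    rw [hHb, show -(2 * b - Real.log ((1 + b) / 2) - b) = -b + Real.log ((1 + b) / 2) by ring,
      Real.exp_add, Real.exp_log (by positivity)]
  have ht : 0 ≤ lam * H - b := by
    have h1 : Real.exp (-(lam * H - b)) ≤ 1 := by
      have h2 := exp_neg_mul_one_add_lt le_rfl hb
      simp only [neg_zero, Real.exp_zero, add_zero, mul_one] at h2
      rw [hexp]; linarith
    have := Real.exp_le_one_iff.1 h1
    linarith
  have hdev := hx.left_deviation_le hlam hn hc (t := H - b / lam)
    (by
      have : b / lam ≤ H := by rw [div_le_iff₀ hlam]; linarith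
      linarith)
    (by
      have : 0 < b / lam := by positivity
      linarith)
  rw [show lam * (H - (H - b / lam)) = b by field_simp; ring,
    show lam * (H - b / lam) = lam * H - b by field_simp] at hdev
  unfold neighborHalf peripheralHalf at hdev
  rw [hexp] at hdev
  linarith

end

end FaultHotelling

theorem corollary4 :
    ∃ c_max c_min α₀ β₀ : ℝ,
      IsGreatest (FaultHotelling.cFun '' Set.Ioi 0) c_max ∧
      FaultHotelling.crossing = {(α₀, β₀)} ∧
      c_min = FaultHotelling.cFun α₀ ∧
      |c_max - 0.232| ≤ 0.0005 ∧
      |c_min - (-0.392)| ≤ 0.0005 ∧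
      ∀ (n : ℕ) (lam H M : ℝ), 2 ≤ n → 0 < lam →
        FaultHotelling.IsCanonicalPair n lam H M →
          1 - c_max ≤ H / M ∧
          ∀ (Ω : Type*) [MeasurableSpace Ω] (P : MeasureTheory.Measure Ω)
            [MeasureTheory.IsProbabilityMeasure P] (F : Ω → Set ℝ),
            FaultHotelling.IsPoissonFaults P lam F →
            3 ≤ n →
            (∃ x : Fin n → ℝ, FaultHotelling.IsNash P F x) →
              H / M ≤ 1 - c_min := by
  obtain ⟨c, hc⟩ := FaultHotelling.exists_isGreatest_cFun
  obtain ⟨α, β, hlo, hhi, hcross⟩ := FaultHotelling.exists_crossing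
  refine ⟨c, FaultHotelling.cFun α, α, β, hc, ?_, rfl,
    FaultHotelling.abs_isGreatest_cFun_sub_le hc, FaultHotelling.abs_cFun_sub_le hlo hhi, ?_⟩
  · ext p
    rw [mem_singleton_iff]
    constructor
    · intro hp
      exact FaultHotelling.crossing_subsingleton hp hcross
    · rintro rfl
      exact hcross
  intro n lam H M _ hlam hpair
  have hM := hpair.M_pos
  have hratio : H / M = 1 - FaultHotelling.cFun (lam * M) := by
    have h := FaultHotelling.eq_sub_log_of_exp_sub_eq (m := lam * M) (h := lam * H)
      (by rw [← mul_sub]; exact hpair.optimal)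
    rw [FaultHotelling.cFun, ← mul_div_mul_left H M hlam.ne', h]
    field_simp
  refine ⟨?_, ?_⟩
  · rw [hratio]
    linarith [hc.2 ⟨lam * M, mul_pos hlam hM, rfl⟩]
  · rintro Ω _ P _ F hF hn ⟨x, hx⟩
    have hx' := hx.isValueNash hlam hF.hasPoissonVoids
    obtain ⟨b, hb, hcurve⟩ := FaultHotelling.exists_curve_partner (mul_pos hlam hM)
    have hle := hx'.curve_le hlam hn hpair hb hcurve
    obtain ⟨hα, hβ, h1, h2⟩ := hcross
    -- If `λM < α`, the inequality at `λM` would propagate strictly to the crossing, where equality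
    -- holds.
    have hαM : α ≤ lam * M := by
      by_contra hcon
      exact absurd h2 (FaultHotelling.curve_lt_of_curve_le (mul_pos hlam hM) hb hβ hcurve h1
        (not_le.1 hcon) hle).ne
    rw [hratio]
    linarith [FaultHotelling.cFun_le_cFun hα (by linarith) hαM]
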